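/- Let $\mathcal H\neq\{0\}$ be a complex Hilbert space. For contractions $T,T'\in\mathcal B(\mathcal H)$, say that $T$ is Harnack dominated by $T'$ if there is a constant $c\ge 1$ such that $\operatorname{Re}p(T)\le c\,\operatorname{Re}p(T')$ for every analytic polynomial $p$ with $\operatorname{Re}p(z)\ge 0$ for $|z|\le 1$. A contraction $T$ is maximal for Harnack domination if the only contraction $T'$ by which it is Harnack dominated is $T'=T$. Let $m$ be normalized Lebesgue measure on the unit circle $\mathbb T$, and let $\xi\otimes\eta$ denote the operator $x\mapsto\langle x,\eta\rangle\xi$. (i) Let $U\in\mathcal B(\mathcal H)$ be an absolutely continuous unitary operator, that is, a unitary operator whose spectral measure $E_U$ is absolutely continuous with respect to $m$. Then $U$ is not maximal for Harnack domination. Moreover, there are a Borel set $\omega\subset\mathbb T$ with $m(\omega)>0$ and a unit vector $\xi\in\mathcal H$ such that $\langle E_U(\cdot)\xi,\xi\rangle=m(\cdot\cap\omega)/m(\omega)$; and for all such $\omega$ and $\xi$ the operator $T=U-U\xi\otimes\xi$ is a contraction different from $U$, and $U$ is Harnack dominated by $T$. (ii) Let $S\in\mathcal B(\mathcal H)$ be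 a unilateral shift of arbitrary multiplicity, that is, an isometry for which there is a closed subspace $\mathcal L\subset\mathcal H$ such that the subspaces $S^n\mathcal L$ ($n\ge 0$) are pairwise orthogonal and span a dense subspace of $\mathcal H$. Then $S$ is not maximal for Harnack domination. Moreover, $\mathcal L$ contains a unit vector, and for every unit vector $\xi\in\mathcal L$ the operator $T=S-S\xi\otimes\xi$ is a contraction different from $S$, and $S$ is Harnack dominated by $T$. -/

import Mathlib

open MeasureTheory Polynomial
open scoped ComplexStarModule CompactlySupported

noncomputable section

namespace HarnackDom

variable {H : Type*} [NormedAddCommGroup H] [InnerProductSpace ℂ H] [CompleteSpace H]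

/-! ### Harnack domination -/

/-- `T` is Harnack dominated by `T'`: there is a constant `c ≥ 1` with `Re p(T) ≤ c Re p(T')`
(in the order of self-adjoint operators) for every analytic polynomial `p` whose real part is
nonnegative on the closed unit disc. -/
def HarnackDominated (T T' : H →L[ℂ] H) : Prop :=
  ∃ c : ℝ, 1 ≤ c ∧ ∀ p : ℂ[X], (∀ z : ℂ, ‖z‖ ≤ 1 → 0 ≤ (p.eval z).re) →
    ((ℜ (aeval T p) : selfAdjoint (H →L[ℂ] H)) : H →L[ℂ] H) ≤
      c • ((ℜ (aeval T' p) : selfAdjoint (H →L[ℂ] H)) : H →L[ℂ] H)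

/-- The contraction `T` is maximal for Harnack domination: the only contraction that Harnack
dominates `T` is `T` itself. -/
def IsHarnackMaximal (T : H →L[ℂ] H) : Prop :=
  ∀ T' : H →L[ℂ] H, ‖T'‖ ≤ 1 → HarnackDominated T T' → T' = T

/-! ### Spectral measures and absolutely continuous unitary operators -/

/-- A real continuous function, regarded as a complex continuous function. -/
def toComplexCont {X : Type*} [TopologicalSpace X] (f : C_c(X, ℝ)) : C(X, ℂ) :=
  ⟨fun x => (f x : ℂ), Complex.continuous_ofReal.comp f.continuous⟩

/-- The positive linear functional `f ↦ ⟨f(N) h, h⟩` on the real continuous functions on the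
spectrum of the normal operator `N`, given by the continuous functional calculus. -/
def spectralFunctional (N : H →L[ℂ] H) [hN : IsStarNormal N] (h : H) :
    C_c(spectrum ℂ N, ℝ) →ₚ[ℝ] ℝ :=
  PositiveLinearMap.mk₀
    { toFun := fun f => (inner ℂ h (cfcHom hN (toComplexCont f) h)).re
      map_add' := by
        intro f g
        have : toComplexCont (f + g) = toComplexCont f + toComplexCont g := by
          ext x; simp [toComplexCont]
        rw [this, map_add, add_apply, inner_add_right, Complex.add_re]
      map_smul' := by
        intro r f
        have : toComplexCont (r • f) = (r : ℂ) • toComplexCont f := by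
          ext x; simp [toComplexCont]
        rw [this, map_smul, smul_apply, inner_smul_right,
          Complex.re_ofReal_mul]
        rfl }
    (by
      intro f hf
      let g : C(spectrum ℂ N, ℂ) :=
        ⟨fun x => ((Real.sqrt (f x) : ℝ) : ℂ),
          Complex.continuous_ofReal.comp (Real.continuous_sqrt.comp f.continuous)⟩
      have hg : toComplexCont f = star g * g := by
        ext x
        have hx : 0 ≤ f x := hf x
        simp only [toComplexCont, g, ContinuousMap.coe_mk, ContinuousMap.mul_apply,
          ContinuousMap.star_apply, Complex.star_def, Complex.conj_ofReal]
        rw [← Complex.ofReal_mul, Real.mul_self_sqrt hx]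
      change 0 ≤ (inner ℂ h (cfcHom hN (toComplexCont f) h)).re
      rw [hg, map_mul, map_star, mul_apply_eq_comp,
        ContinuousLinearMap.star_eq_adjoint, ContinuousLinearMap.adjoint_inner_right]
      exact inner_self_nonneg (𝕜 := ℂ))

/-- The scalar spectral measure `μ_h = ⟨E_N(·) h, h⟩` of the normal operator `N` at the vector
`h`: the Borel measure on `ℂ`, carried by the spectrum of `N`, that represents the functional
`f ↦ ⟨f(N) h, h⟩`. -/
def spectralMeasure (N : H →L[ℂ] H) [IsStarNormal N] (h : H) : Measure ℂ :=
  (RealRMK.rieszMeasure (spectralFunctional N h)).map Subtype.val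

/-- Normalized Lebesgue measure `m` on the unit circle, as a measure on `ℂ`. -/
def circleMeasure : Measure ℂ :=
  (ENNReal.ofReal (2 * Real.pi))⁻¹ •
    (volume.restrict (Set.Ioc 0 (2 * Real.pi))).map
      (fun t : ℝ => Complex.exp ((t : ℂ) * Complex.I))

/-- A unitary operator is absolutely continuous if its spectral measure is absolutely continuous
with respect to `m`; since `⟨E_U(B) h, h⟩ = ‖E_U(B) h‖ ^ 2`, this means that all the measures
`⟨E_U(·) h, h⟩` are. -/
def IsAbsContUnitary (U : unitary (H →L[ℂ] H)) : Prop :=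
  ∀ h : H, spectralMeasure (U : H →L[ℂ] H) h ≪ circleMeasure

/-! ### Unilateral shifts and rank-one perturbations -/

/-- `S` is a unilateral shift with wandering subspace `L`: `S` is an isometry, `L` is a closed
subspace, the subspaces `L, S L, S² L, …` are pairwise orthogonal and together they span a dense
subspace. The multiplicity of the shift is the Hilbert space dimension of `L`. -/
structure IsUnilateralShift (S : H →L[ℂ] H) (L : Submodule ℂ H) : Prop where
  isometry : ∀ x : H, ‖S x‖ = ‖x‖
  isClosed : IsClosed (L : Set H)
  orthogonal : ∀ m n : ℕ, m ≠ n → ∀ x ∈ L, ∀ y ∈ L, inner ℂ ((S ^ m) x) ((S ^ n) y) = 0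
  dense : (⨆ n : ℕ, L.map ((S ^ n : H →L[ℂ] H) : H →ₗ[ℂ] H)).topologicalClosure = ⊤

/-- The rank-one perturbation `T - Tξ ⊗ ξ`, where `(a ⊗ b) x = ⟨x, b⟩ a`. -/
def rankOnePerturbation (T : H →L[ℂ] H) (ξ : H) : H →L[ℂ] H :=
  T - InnerProductSpace.rankOne ℂ (T ξ) ξ

end HarnackDom

end

/-! For a contraction `A` and `|z| < 1`, put `y = (1 - zA)⁻¹ h`. The Poisson kernel of `A`, taken at
`h`, is `2 Re ⟨y, h⟩ - ‖h‖² = ‖y‖² - |z|² ‖A y‖²`. Integrating against `Re p` on the circle turns an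
inequality between the Poisson kernels of two contractions, uniform in `z` and `h`, into Harnack
domination (`harnackDominated_of_poisson_le`).

For an isometry `V` the kernel is `(1 - |z|²) ‖y‖²`. The perturbation `T = V - Vξ ⊗ ξ` satisfies `‖T
x‖² = ‖x‖² - |⟨x, ξ⟩|²`, so its kernel gains the term `|z|² |⟨y, ξ⟩|²`, where now `y = (1 - zT)⁻¹
h`. The resolvents of `V` and `T` at `h` differ by `z ⟨y, ξ⟩ (1 - zV)⁻¹ V ξ`, and this extra term
absorbs the difference as soon as the kernel of `V` at `ξ` is bounded in `z`
(`harnackDominated_rankOnePerturbation`). Since `T` kills `ξ` and `V` does not, `V` is then not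
maximal.

For a shift and a unit wandering vector the kernel at `ξ` is identically 1. For a unitary operator
it is the Poisson integral of the spectral measure at `ξ`, hence at most `1 / m(ω)` when that
measure is `m` restricted to `ω` and normalized. Absolute continuity supplies such a `ξ`: cut the
density of some spectral measure down to a set where it is nonzero and finite, and divide it out by
the functional calculus. -/

namespace HarnackDom

/-! ### Fourier series on the circle and positivity -/

open Complex in
theorem integral_exp_int_mul_I (m : ℤ) :
    ∫ θ in (0 : ℝ)..2 * Real.pi, exp (m * (θ * I)) = if m = 0 then 2 * (Real.pi : ℂ) else 0 := by
  split_ifs with h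
  · simp [h]
  · have h2 : (m : ℂ) * I ≠ 0 := by simp [h]
    have := integral_exp_mul_complex (a := 0) (b := 2 * Real.pi) h2
    have h3 : ∀ θ : ℝ, exp (m * (θ * I)) = exp (m * I * θ) := fun θ => by ring_nf
    simp_rw [h3]
    rw [this]
    have h4 : exp (m * I * (2 * Real.pi : ℝ)) = 1 := by
      rw [Complex.exp_eq_one_iff]
      exact ⟨m, by push_cast; ring⟩
    rw [h4]
    simp

/-- The integral of a power series with bounded coefficients against a character of the circle. -/
theorem integral_exp_mul_tsum {d : ℕ → ℂ} {M r : ℝ} (hd : ∀ n, ‖d n‖ ≤ M) (hr : 0 ≤ r)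
    (hr1 : r < 1) (j : ℤ) :
    ∫ θ in (0 : ℝ)..2 * Real.pi, Complex.exp (j * (θ * Complex.I)) *
        ∑' n, d n * (r * Complex.exp (-(θ * Complex.I))) ^ n =
      ∑' n : ℕ, d n * r ^ n * if j = n then 2 * (Real.pi : ℂ) else 0 := by
  have hs : Summable fun n : ℕ => M * r ^ n := (summable_geometric_of_lt_one hr hr1).mul_left M
  have key := intervalIntegral.hasSum_integral_of_dominated_convergence (a := 0)
    (b := 2 * Real.pi) (μ := volume)
    (F := fun (n : ℕ) (θ : ℝ) => Complex.exp (j * (θ * Complex.I)) *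
      (d n * (r * Complex.exp (-(θ * Complex.I))) ^ n))
    (f := fun θ : ℝ => Complex.exp (j * (θ * Complex.I)) *
        ∑' n, d n * (r * Complex.exp (-(θ * Complex.I))) ^ n)
    (fun n _ => M * r ^ n)
    (fun n => by
      apply Continuous.aestronglyMeasurable
      fun_prop)
    (fun n => by
      refine .of_forall fun θ _ => ?_
      have h1 : ‖Complex.exp (j * (θ * Complex.I))‖ = 1 := by
        simpa [mul_assoc] using Complex.norm_exp_ofReal_mul_I (j * θ)
      have h2 : ‖Complex.exp (-(θ * Complex.I))‖ = 1 := by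
        simpa using Complex.norm_exp_ofReal_mul_I (-θ)
      rw [norm_mul, h1, norm_mul, norm_pow, norm_mul, h2, Complex.norm_real, Real.norm_of_nonneg hr,
        one_mul, mul_one]
      gcongr
      exact hd n)
    (.of_forall fun _ _ => hs)
    (by simp)
    (by
      refine .of_forall fun θ _ => ?_
      apply HasSum.mul_left
      apply Summable.hasSum
      refine Summable.of_norm_bounded hs fun n => ?_
      have h2 : ‖Complex.exp (-(θ * Complex.I))‖ = 1 := by
        simpa using Complex.norm_exp_ofReal_mul_I (-θ)
      rw [norm_mul, norm_pow, norm_mul, h2, Complex.norm_real, Real.norm_of_nonneg hr, mul_one]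
      gcongr
      exact hd n)
  rw [← key.tsum_eq]
  congr 1
  ext n
  have h3 : ∀ θ : ℝ, Complex.exp (j * (θ * Complex.I)) *
      (d n * (r * Complex.exp (-(θ * Complex.I))) ^ n) =
      (d n * r ^ n) * Complex.exp ((j - n : ℤ) * (θ * Complex.I)) := by
    intro θ
    rw [mul_pow, ← Complex.exp_nat_mul]
    have : ((j - n : ℤ) : ℂ) * (θ * Complex.I) = j * (θ * Complex.I) + n * -(θ * Complex.I) := by
      push_cast; ring
    rw [this, Complex.exp_add]
    ring
  simp_rw [h3]
  rw [intervalIntegral.integral_const_mul, integral_exp_int_mul_I]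
  simp [sub_eq_zero]

theorem continuous_tsum_exp {d : ℕ → ℂ} {M r : ℝ} (hd : ∀ n, ‖d n‖ ≤ M) (hr : 0 ≤ r)
    (hr1 : r < 1) :
    Continuous fun θ : ℝ => ∑' n, d n * (r * Complex.exp (-(θ * Complex.I))) ^ n := by
  have hs : Summable fun n : ℕ => M * r ^ n := (summable_geometric_of_lt_one hr hr1).mul_left M
  refine continuous_tsum (fun n => by fun_prop) hs fun n θ => ?_
  have h2 : ‖Complex.exp (-(θ * Complex.I))‖ = 1 := by
    simpa using Complex.norm_exp_ofReal_mul_I (-θ)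
  rw [norm_mul, norm_pow, norm_mul, h2, Complex.norm_real, Real.norm_of_nonneg hr, mul_one]
  gcongr
  exact hd n

/-- Up to the factor `2π`, the sum is the integral over the circle of `Re p` times the real Poisson
extension of `d` at radius `r`; both factors are nonnegative. -/
theorem re_sum_coeff_mul_pow_nonneg {d : ℕ → ℂ} {M r : ℝ} (hd : ∀ n, ‖d n‖ ≤ M) (hr : 0 ≤ r)
    (hr1 : r < 1) (hd0 : (d 0).im = 0)
    (hpos : ∀ z : ℂ, ‖z‖ < 1 → 0 ≤ 2 * (∑' n, d n * z ^ n).re - (d 0).re)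
    {p : ℂ[X]} (hp : ∀ z : ℂ, ‖z‖ ≤ 1 → 0 ≤ (p.eval z).re) :
    0 ≤ (∑ k ∈ p.support, p.coeff k * (d k * r ^ k)).re := by
  -- The negative frequencies in `F` meet the positive ones of `P`, so that integrating `P F` leaves
  -- exactly the products `p_k d_k r ^ k`.
  set F : ℝ → ℂ := fun θ => ∑' n, d n * (r * Complex.exp (-(θ * Complex.I))) ^ n with hF
  have hFc : Continuous F := continuous_tsum_exp hd hr hr1
  set P : ℝ → ℂ := fun θ => p.eval (Complex.exp (θ * Complex.I)) with hP
  have hPc : Continuous P := by fun_prop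
  have hPs : ∀ θ, P θ = ∑ k ∈ p.support, p.coeff k * Complex.exp ((k : ℤ) * (θ * Complex.I)) := by
    intro θ
    simp only [hP, Polynomial.eval_eq_sum, Polynomial.sum_def]
    refine Finset.sum_congr rfl fun k _ => ?_
    rw [← Complex.exp_nat_mul]; simp
  have hPs' : ∀ θ, (starRingEnd ℂ) (P θ) = ∑ k ∈ p.support,
      (starRingEnd ℂ) (p.coeff k) * Complex.exp ((-k : ℤ) * (θ * Complex.I)) := by
    intro θ
    rw [hPs, map_sum]
    refine Finset.sum_congr rfl fun k _ => ?_
    rw [map_mul, ← Complex.exp_conj]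
    simp
  have i1 : ∫ θ in (0 : ℝ)..2 * Real.pi, P θ * F θ =
      2 * Real.pi * ∑ k ∈ p.support, p.coeff k * (d k * r ^ k) := by
    simp_rw [hPs, Finset.sum_mul, mul_assoc]
    rw [intervalIntegral.integral_finsetSum
      (fun k _ => Continuous.intervalIntegrable (by fun_prop) _ _), Finset.mul_sum, Finset.mul_sum]
    refine Finset.sum_congr rfl fun k _ => ?_
    rw [intervalIntegral.integral_const_mul, integral_exp_mul_tsum hd hr hr1,
      tsum_eq_single k (by
        intro n hn
        rw [if_neg (by exact_mod_cast hn.symm), mul_zero])]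
    simp; ring
  -- Both factors now have frequencies at most 0, so only the constant terms survive.
  have i2 : ∫ θ in (0 : ℝ)..2 * Real.pi, (starRingEnd ℂ) (P θ) * F θ =
      2 * Real.pi * ((starRingEnd ℂ) (p.coeff 0) * d 0) := by
    simp_rw [hPs', Finset.sum_mul, mul_assoc]
    rw [intervalIntegral.integral_finsetSum
      (fun k _ => Continuous.intervalIntegrable (by fun_prop) _ _)]
    rw [Finset.sum_eq_single 0]
    · rw [intervalIntegral.integral_const_mul, integral_exp_mul_tsum hd hr hr1,
        tsum_eq_single (0 : ℕ) (by
          intro n hn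
          rw [if_neg (by push_cast; omega), mul_zero])]
      simp; ring
    · intro k _ hk
      have hk' : ∀ n : ℕ, -(k : ℤ) ≠ n := by omega
      rw [intervalIntegral.integral_const_mul, integral_exp_mul_tsum hd hr hr1]
      simp [hk']
    · intro h
      simp [Polynomial.notMem_support_iff.mp h]
  have i3 : ∫ θ in (0 : ℝ)..2 * Real.pi, P θ = 2 * Real.pi * p.coeff 0 := by
    simp_rw [hPs]
    rw [intervalIntegral.integral_finsetSum
      (fun k _ => Continuous.intervalIntegrable (by fun_prop) _ _), Finset.sum_eq_single 0]
    · rw [intervalIntegral.integral_const_mul, integral_exp_int_mul_I]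
      simp; ring
    · intro k _ hk
      rw [intervalIntegral.integral_const_mul, integral_exp_int_mul_I]
      simp [hk]
    · intro h
      simp [Polynomial.notMem_support_iff.mp h]
  -- As `d 0` is real, the integrand is `Re P · (2 Re F - d 0)`. The contributions of `conj P · F`
  -- and `d 0 · P` have equal real parts and cancel.
  have hnn : 0 ≤ ∫ θ in (0 : ℝ)..2 * Real.pi,
      (P θ * F θ + (starRingEnd ℂ) (P θ) * F θ - d 0 * P θ).re := by
    apply intervalIntegral.integral_nonneg (by positivity)
    intro θ _
    have h1 : 0 ≤ (P θ).re := hp _ (by rw [Complex.norm_exp_ofReal_mul_I])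
    have h2 : 0 ≤ 2 * (F θ).re - (d 0).re := by
      apply hpos
      have h2 : ‖Complex.exp (-(θ * Complex.I))‖ = 1 := by
        simpa using Complex.norm_exp_ofReal_mul_I (-θ)
      rw [norm_mul, h2, Complex.norm_real, Real.norm_of_nonneg hr, mul_one]
      exact hr1
    have := mul_nonneg h1 h2
    simp [hd0]
    linarith
  have hre : ∀ f : ℝ → ℂ, Continuous f → ∫ θ in (0 : ℝ)..2 * Real.pi, (f θ).re =
      (∫ θ in (0 : ℝ)..2 * Real.pi, f θ).re := fun f hf =>
    (Complex.reCLM.intervalIntegral_comp_comm (hf.intervalIntegrable _ _))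
  rw [hre _ (by fun_prop), intervalIntegral.integral_sub
    (Continuous.intervalIntegrable (by fun_prop) _ _)
    (Continuous.intervalIntegrable (by fun_prop) _ _), intervalIntegral.integral_add
    (Continuous.intervalIntegrable (by fun_prop) _ _)
    (Continuous.intervalIntegrable (by fun_prop) _ _), intervalIntegral.integral_const_mul,
    i1, i2, i3] at hnn
  have hsimp : (2 * (Real.pi : ℂ) * (∑ k ∈ p.support, p.coeff k * (d k * r ^ k)) +
      2 * Real.pi * ((starRingEnd ℂ) (p.coeff 0) * d 0) - d 0 * (2 * Real.pi * p.coeff 0)).re =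
      2 * Real.pi * (∑ k ∈ p.support, p.coeff k * (d k * r ^ k)).re := by
    generalize (∑ k ∈ p.support, p.coeff k * (d k * r ^ k)) = s
    simp [hd0]
    ring
  rw [hsimp] at hnn
  exact nonneg_of_mul_nonneg_right hnn (by positivity)

/-- A sequence whose real Poisson extension is nonnegative on the disc pairs nonnegatively with
every polynomial of nonnegative real part on the disc. -/
theorem re_sum_coeff_mul_nonneg {d : ℕ → ℂ} {M : ℝ} (hd : ∀ n, ‖d n‖ ≤ M) (hd0 : (d 0).im = 0)
    (hpos : ∀ z : ℂ, ‖z‖ < 1 → 0 ≤ 2 * (∑' n, d n * z ^ n).re - (d 0).re)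
    {p : ℂ[X]} (hp : ∀ z : ℂ, ‖z‖ ≤ 1 → 0 ≤ (p.eval z).re) :
    0 ≤ (∑ k ∈ p.support, p.coeff k * d k).re := by
  -- Let `r` increase to 1 in the finite sum.
  have hc : Continuous fun r : ℝ => (∑ k ∈ p.support, p.coeff k * (d k * r ^ k)).re := by fun_prop
  have ht := (hc.tendsto 1).mono_left (nhdsWithin_le_nhds (s := Set.Iio 1))
  have h := ge_of_tendsto ht (b := 0) ?_
  · simpa using h
  · filter_upwards [Ioo_mem_nhdsLT (zero_lt_one' ℝ)] with r hr
    exact re_sum_coeff_mul_pow_nonneg hd hr.1.le hr.2 hd0 hpos hp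

/-! ### Poisson kernels of contractions -/

variable {H : Type*} [NormedAddCommGroup H] [InnerProductSpace ℂ H] [CompleteSpace H]

/-- The Neumann series of `1 - z A`. -/
noncomputable def resolventSeries (A : H →L[ℂ] H) (z : ℂ) : H →L[ℂ] H := ∑' n, (z • A) ^ n

theorem norm_smul_lt_one {A : H →L[ℂ] H} (hA : ‖A‖ ≤ 1) {z : ℂ} (hz : ‖z‖ < 1) : ‖z • A‖ < 1 := by
  rw [norm_smul]
  calc ‖z‖ * ‖A‖ ≤ ‖z‖ * 1 := by gcongr
    _ < 1 := by simpa using hz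

theorem one_sub_mul_resolventSeries {A : H →L[ℂ] H} (hA : ‖A‖ ≤ 1) {z : ℂ} (hz : ‖z‖ < 1) :
    (1 - z • A) * resolventSeries A z = 1 := mul_neg_geom_series _ (norm_smul_lt_one hA hz)

theorem resolventSeries_mul_one_sub {A : H →L[ℂ] H} (hA : ‖A‖ ≤ 1) {z : ℂ} (hz : ‖z‖ < 1) :
    resolventSeries A z * (1 - z • A) = 1 := geom_series_mul_neg _ (norm_smul_lt_one hA hz)

theorem resolventSeries_sub {A : H →L[ℂ] H} (hA : ‖A‖ ≤ 1) {z : ℂ} (hz : ‖z‖ < 1) (h : H) :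
    resolventSeries A z h - z • A (resolventSeries A z h) = h := by
  simpa using DFunLike.congr_fun (one_sub_mul_resolventSeries hA hz) h

theorem resolventSeries_apply_sub {A : H →L[ℂ] H} (hA : ‖A‖ ≤ 1) {z : ℂ} (hz : ‖z‖ < 1) (y : H) :
    resolventSeries A z (y - z • A y) = y := by
  simpa using DFunLike.congr_fun (resolventSeries_mul_one_sub hA hz) y

theorem apply_resolventSeries {A : H →L[ℂ] H} (hA : ‖A‖ ≤ 1) {z : ℂ} (hz : ‖z‖ < 1) (h : H) :
    A (resolventSeries A z h) = resolventSeries A z (A h) := by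
  rw [← resolventSeries_apply_sub hA hz (A (resolventSeries A z h)), ← map_smul, ← map_sub,
    resolventSeries_sub hA hz]

theorem hasSum_inner_resolventSeries {A : H →L[ℂ] H} (hA : ‖A‖ ≤ 1) {z : ℂ} (hz : ‖z‖ < 1)
    (h : H) :
    HasSum (fun n => inner ℂ h ((A ^ n) h) * z ^ n) (inner ℂ h (resolventSeries A z h)) := by
  have h1 : HasSum (fun n => (z • A) ^ n) (resolventSeries A z) :=
    (summable_geometric_of_norm_lt_one (norm_smul_lt_one hA hz)).hasSum
  have h2 := ((innerSL ℂ h).comp (ContinuousLinearMap.apply ℂ H h)).hasSum h1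
  refine h2.congr_fun fun n => ?_
  simp only [Function.comp_apply, ContinuousLinearMap.coe_comp, ContinuousLinearMap.apply_apply,
    innerSL_apply_apply, _root_.smul_pow, smul_apply, inner_smul_right, mul_comm]

/-- With `y` the resolvent at `h`, expand the square of `z • A y = y - h`. The right-hand side is
the form in which kernels are compared below. -/
theorem two_re_inner_resolventSeries_sub {A : H →L[ℂ] H} (hA : ‖A‖ ≤ 1) {z : ℂ} (hz : ‖z‖ < 1)
    (h : H) :
    2 * (inner ℂ h (resolventSeries A z h)).re - ‖h‖ ^ 2 =
      ‖resolventSeries A z h‖ ^ 2 - ‖z‖ ^ 2 * ‖A (resolventSeries A z h)‖ ^ 2 := by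
  set y := resolventSeries A z h with hy
  have e : y - z • A y = h := resolventSeries_sub hA hz h
  have h1 : ‖z • A y‖ ^ 2 = ‖y‖ ^ 2 - 2 * (inner ℂ h y).re + ‖h‖ ^ 2 := by
    have : z • A y = y - h := by rw [← e]; abel
    rw [this, @norm_sub_sq ℂ, inner_re_symm]; rfl
  rw [norm_smul, mul_pow] at h1
  linarith

omit [CompleteSpace H] in
theorem norm_pow_apply_le {A : H →L[ℂ] H} (hA : ‖A‖ ≤ 1) (n : ℕ) (h : H) : ‖(A ^ n) h‖ ≤ ‖h‖ := by
  have h1 : ‖A ^ n‖ ≤ 1 := by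
    rcases n with _ | n
    · rw [pow_zero]
      exact ContinuousLinearMap.norm_id_le
    · exact (norm_pow_le' A n.succ_pos).trans (pow_le_one₀ (norm_nonneg _) hA)
  simpa using (A ^ n).le_of_opNorm_le h1 h

/-- Harnack domination follows from the pointwise domination of Poisson kernels. -/
theorem harnackDominated_of_poisson_le {A B : H →L[ℂ] H} (hA : ‖A‖ ≤ 1) (hB : ‖B‖ ≤ 1) {c : ℝ}
    (hc : 1 ≤ c)
    (hle : ∀ z : ℂ, ‖z‖ < 1 → ∀ h : H,
      ‖resolventSeries A z h‖ ^ 2 - ‖z‖ ^ 2 * ‖A (resolventSeries A z h)‖ ^ 2 ≤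
      c * (‖resolventSeries B z h‖ ^ 2 - ‖z‖ ^ 2 * ‖B (resolventSeries B z h)‖ ^ 2)) :
    HarnackDominated A B := by
  refine ⟨c, hc, fun p hp => ?_⟩
  have hre : ∀ (X : H →L[ℂ] H) (h : H),
      (inner ℂ h (((ℜ X : selfAdjoint (H →L[ℂ] H)) : H →L[ℂ] H) h)).re = (inner ℂ h (X h)).re := by
    intro X h
    rw [realPart_apply_coe, smul_apply, add_apply, ContinuousLinearMap.star_eq_adjoint,
      ← Complex.coe_smul, inner_smul_right, inner_add_right,
      ContinuousLinearMap.adjoint_inner_right, Complex.re_ofReal_mul, Complex.add_re,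
      ← inner_conj_symm (X h) h, Complex.conj_re]
    ring
  have haev : ∀ (X : H →L[ℂ] H) (h : H), inner ℂ h (aeval X p h) =
      ∑ k ∈ p.support, p.coeff k * inner ℂ h ((X ^ k) h) := by
    intro X h
    rw [aeval_def, eval₂_eq_sum, Polynomial.sum_def, sum_apply, inner_sum]
    refine Finset.sum_congr rfl fun k _ => ?_
    rw [← Algebra.smul_def, smul_apply, inner_smul_right]
  rw [ContinuousLinearMap.le_def, ContinuousLinearMap.isPositive_def']
  refine ⟨?_, fun h => ?_⟩
  · exact (IsSelfAdjoint.smul (by simp [IsSelfAdjoint]) (ℜ (aeval B p)).2).sub (ℜ (aeval A p)).2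
  rw [ContinuousLinearMap.reApplyInnerSelf_apply, inner_re_symm]
  -- These `d n` are the moments of `c` times the kernel of `B` minus the kernel of `A`, so `hle` is
  -- the positivity of their Poisson extension.
  have key := re_sum_coeff_mul_nonneg
    (d := fun n => c * inner ℂ h ((B ^ n) h) - inner ℂ h ((A ^ n) h)) (M := (c + 1) * ‖h‖ ^ 2)
    (fun n => by
      have hb : ∀ X : H →L[ℂ] H, ‖X‖ ≤ 1 → ‖inner ℂ h ((X ^ n) h)‖ ≤ ‖h‖ ^ 2 := fun X hX =>
        (norm_inner_le_norm _ _).trans (by rw [sq]; gcongr; exact norm_pow_apply_le hX n h)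
      refine (norm_sub_le _ _).trans ?_
      rw [norm_mul, Complex.norm_real, Real.norm_of_nonneg (by linarith), add_mul, one_mul]
      gcongr
      · exact hb B hB
      · exact hb A hA)
    (by simp [inner_self_eq_norm_sq_to_K, ← Complex.ofReal_pow])
    (fun z hz => by
      have hs := ((hasSum_inner_resolventSeries hB hz h).mul_left (c : ℂ)).sub
        (hasSum_inner_resolventSeries hA hz h)
      have hs' : HasSum (fun n => (c * inner ℂ h ((B ^ n) h) - inner ℂ h ((A ^ n) h)) * z ^ n) _ :=
        hs.congr_fun fun n => by ring
      rw [hs'.tsum_eq]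
      have h1 := two_re_inner_resolventSeries_sub hA hz h
      have h2 := two_re_inner_resolventSeries_sub hB hz h
      have h3 := hle z hz h
      rw [← h1, ← h2] at h3
      simp [inner_self_eq_norm_sq_to_K, ← Complex.ofReal_pow]
      linarith)
    hp
  have h1 := hre (aeval A p) h
  have h2 := hre (aeval B p) h
  rw [haev] at h1 h2
  rw [sub_apply, smul_apply, inner_sub_right, map_sub]
  have h3 : RCLike.re (inner ℂ h (c • ((ℜ (aeval B p) : selfAdjoint (H →L[ℂ] H)) : H →L[ℂ] H) h)) =
      c * (inner ℂ h (((ℜ (aeval B p) : selfAdjoint (H →L[ℂ] H)) : H →L[ℂ] H) h)).re := by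
    rw [← Complex.coe_smul, inner_smul_right]
    exact Complex.re_ofReal_mul _ _
  rw [h3, h2]
  change 0 ≤ _ - (inner ℂ h (((ℜ (aeval A p) : selfAdjoint (H →L[ℂ] H)) : H →L[ℂ] H) h)).re
  rw [h1, ← Complex.re_ofReal_mul, ← Complex.sub_re, Finset.mul_sum, ← Finset.sum_sub_distrib]
  convert key using 4
  ring

/-! ### Rank-one perturbations of isometries -/

omit [CompleteSpace H] in
theorem rankOnePerturbation_apply (V : H →L[ℂ] H) (ξ x : H) :
    rankOnePerturbation V ξ x = V x - inner ℂ ξ x • V ξ := by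
  simp [rankOnePerturbation]

-- The perturbation is `V` composed with the orthogonal projection onto the complement of `ξ`:
-- Pythagoras.
omit [CompleteSpace H] in
theorem norm_rankOnePerturbation_apply_sq {V : H →L[ℂ] H} (hV : ∀ x, ‖V x‖ = ‖x‖) {ξ : H}
    (hξ : ‖ξ‖ = 1) (x : H) :
    ‖rankOnePerturbation V ξ x‖ ^ 2 = ‖x‖ ^ 2 - ‖inner ℂ ξ x‖ ^ 2 := by
  rw [rankOnePerturbation_apply, ← map_smul, ← map_sub, hV, @norm_sub_sq ℂ, inner_smul_right,
    norm_smul, hξ, ← inner_conj_symm x ξ, Complex.mul_conj']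
  norm_cast
  rw [show RCLike.re ((‖inner ℂ ξ x‖ ^ 2 : ℝ) : ℂ) = ‖inner ℂ ξ x‖ ^ 2 from Complex.ofReal_re _, mul_one]
  ring

omit [CompleteSpace H] in
theorem norm_rankOnePerturbation_le {V : H →L[ℂ] H} (hV : ∀ x, ‖V x‖ = ‖x‖) {ξ : H}
    (hξ : ‖ξ‖ = 1) : ‖rankOnePerturbation V ξ‖ ≤ 1 := by
  refine ContinuousLinearMap.opNorm_le_bound _ zero_le_one fun x => ?_
  rw [one_mul]
  refine le_of_sq_le_sq ?_ (norm_nonneg _)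
  rw [norm_rankOnePerturbation_apply_sq hV hξ]
  linarith [sq_nonneg ‖inner ℂ ξ x‖]

-- The perturbation kills `ξ`, whereas `V ξ` has norm 1.
omit [CompleteSpace H] in
theorem rankOnePerturbation_ne {V : H →L[ℂ] H} (hV : ∀ x, ‖V x‖ = ‖x‖) {ξ : H}
    (hξ : ‖ξ‖ = 1) : rankOnePerturbation V ξ ≠ V := by
  intro h
  have h1 := norm_rankOnePerturbation_apply_sq hV hξ ξ
  rw [h, hV, hξ, inner_self_eq_norm_sq_to_K, hξ] at h1
  norm_num at h1

/-- An isometry is Harnack dominated by its perturbation `V - Vξ ⊗ ξ` as soon as the Poisson kernel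
of `V` at `ξ` is bounded. -/
theorem harnackDominated_rankOnePerturbation {V : H →L[ℂ] H} (hV : ∀ x, ‖V x‖ = ‖x‖) {ξ : H}
    (hξ : ‖ξ‖ = 1) {C : ℝ}
    (hC : ∀ z : ℂ, ‖z‖ < 1 → (1 - ‖z‖ ^ 2) * ‖resolventSeries V z ξ‖ ^ 2 ≤ C) :
    HarnackDominated V (rankOnePerturbation V ξ) := by
  have hV1 : ‖V‖ ≤ 1 := ContinuousLinearMap.opNorm_le_bound _ zero_le_one fun x => by simp [hV]
  have hT1 := norm_rankOnePerturbation_le hV hξ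
  -- The 2 pays for the term `(1 - ‖z‖ ^ 2) * ‖y‖ ^ 2` of the perturbed kernel, and `2 * C` for its
  -- rank-one term `‖z‖ ^ 2 * ‖a‖ ^ 2`.
  refine harnackDominated_of_poisson_le (c := max 2 (2 * C)) hV1 hT1
    ((by norm_num : (1 : ℝ) ≤ 2).trans (le_max_left _ _)) fun z hz h => ?_
  rw [norm_rankOnePerturbation_apply_sq hV hξ, hV]
  set y := resolventSeries (rankOnePerturbation V ξ) z h with hy
  set a := inner ℂ ξ y
  -- Apply the resolvent of `V` to `h = (y - z V y) + z a V ξ`.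
  have e1 : resolventSeries V z h = y + (z * a) • resolventSeries V z (V ξ) := by
    have : h = (y - z • V y) + (z * a) • V ξ := by
      have := resolventSeries_sub hT1 hz h
      rw [← hy, rankOnePerturbation_apply] at this
      rw [← this, smul_sub, smul_smul]
      abel
    conv_lhs => rw [this]
    rw [map_add, resolventSeries_apply_sub hV1 hz, map_smul]
  have e2 : ‖resolventSeries V z (V ξ)‖ = ‖resolventSeries V z ξ‖ := by
    rw [← apply_resolventSeries hV1 hz, hV]
  set q := ‖resolventSeries V z ξ‖ with hq
  have hz2 : 0 ≤ 1 - ‖z‖ ^ 2 := by nlinarith [norm_nonneg z]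
  have hn : ‖resolventSeries V z h‖ ≤ ‖y‖ + ‖z‖ * ‖a‖ * q := by
    rw [e1]
    refine (norm_add_le _ _).trans ?_
    rw [norm_smul, norm_mul, e2]
  have hn2 : ‖resolventSeries V z h‖ ^ 2 ≤ 2 * ‖y‖ ^ 2 + 2 * (‖z‖ * ‖a‖) ^ 2 * q ^ 2 := by
    refine (pow_le_pow_left₀ (norm_nonneg _) hn 2).trans ?_
    nlinarith [sq_nonneg (‖y‖ - ‖z‖ * ‖a‖ * q)]
  have h3 : (1 - ‖z‖ ^ 2) * ‖resolventSeries V z h‖ ^ 2 ≤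
      2 * ((1 - ‖z‖ ^ 2) * ‖y‖ ^ 2) + (2 * C) * (‖z‖ * ‖a‖) ^ 2 := by
    refine (mul_le_mul_of_nonneg_left hn2 hz2).trans ?_
    have := mul_le_mul_of_nonneg_left (hC z hz) (sq_nonneg (‖z‖ * ‖a‖))
    linarith
  have h4 : 2 * ((1 - ‖z‖ ^ 2) * ‖y‖ ^ 2) ≤ max 2 (2 * C) * ((1 - ‖z‖ ^ 2) * ‖y‖ ^ 2) := by
    gcongr
    exact le_max_left _ _
  have h5 : (2 * C) * (‖z‖ * ‖a‖) ^ 2 ≤ max 2 (2 * C) * (‖z‖ * ‖a‖) ^ 2 := by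
    gcongr
    exact le_max_right _ _
  linarith

/-! ### Unilateral shifts -/

theorem IsUnilateralShift.harnackDominated {S : H →L[ℂ] H} {L : Submodule ℂ H}
    (hS : IsUnilateralShift S L) {ξ : H} (hξL : ξ ∈ L) (hξ : ‖ξ‖ = 1) :
    HarnackDominated S (rankOnePerturbation S ξ) := by
  refine harnackDominated_rankOnePerturbation hS.isometry hξ (C := 1) fun z hz => ?_
  have hS1 : ‖S‖ ≤ 1 :=
    ContinuousLinearMap.opNorm_le_bound _ zero_le_one fun x => by simp [hS.isometry]
  have h1 := two_re_inner_resolventSeries_sub hS1 hz ξ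
  -- Wandering makes every moment `⟨S ^ n ξ, ξ⟩` with `n ≥ 1` vanish, so the kernel at `ξ` is
  -- constantly 1.
  have h2 := (hasSum_inner_resolventSeries hS1 hz ξ).unique (hasSum_single 0 fun n hn => by
    rw [show inner ℂ ξ ((S ^ n) ξ) = 0 by
      simpa using hS.orthogonal 0 n hn.symm ξ hξL ξ hξL, zero_mul])
  rw [h2, hS.isometry] at h1
  simp [hξ] at h1
  linarith

omit [CompleteSpace H] in
theorem IsUnilateralShift.exists_norm_eq_one [Nontrivial H] {S : H →L[ℂ] H} {L : Submodule ℂ H}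
    (hS : IsUnilateralShift S L) : ∃ ξ ∈ L, ‖ξ‖ = 1 := by
  by_cases hL : L = ⊥
  · have := hS.dense
    simp [hL] at this
  · obtain ⟨x, hx, hx0⟩ := L.exists_mem_ne_zero_of_ne_bot hL
    exact ⟨((‖x‖⁻¹ : ℝ) : ℂ) • x, L.smul_mem _ hx, by simp [norm_smul, hx0]⟩

/-! ### Scalar spectral measures and their densities -/

/-- A real continuous function on a space, regarded as a complex one. -/
def ofRealCont {X : Type*} [TopologicalSpace X] (f : C(X, ℝ)) : C(X, ℂ) :=
  ⟨fun x => (f x : ℂ), Complex.continuous_ofReal.comp f.continuous⟩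

theorem star_ofRealCont {X : Type*} [TopologicalSpace X] (f : C(X, ℝ)) :
    star (ofRealCont f) = ofRealCont f := by
  ext x; simp [ofRealCont]

theorem ofRealCont_mul {X : Type*} [TopologicalSpace X] (f g : C(X, ℝ)) :
    ofRealCont (f * g) = ofRealCont f * ofRealCont g := by
  ext x; simp [ofRealCont]

theorem ofRealCont_sub {X : Type*} [TopologicalSpace X] (f g : C(X, ℝ)) :
    ofRealCont (f - g) = ofRealCont f - ofRealCont g := by
  ext x; simp [ofRealCont]

/-- The scalar spectral measure as a measure on the spectrum. -/
noncomputable def spectrumMeasure (N : H →L[ℂ] H) [IsStarNormal N] (h : H) :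
    Measure (spectrum ℂ N) := RealRMK.rieszMeasure (spectralFunctional N h)

instance regular_spectrumMeasure (N : H →L[ℂ] H) [IsStarNormal N] (h : H) :
    (spectrumMeasure N h).Regular :=
  inferInstanceAs (RealRMK.rieszMeasure (spectralFunctional N h)).Regular

instance isFiniteMeasure_spectrumMeasure (N : H →L[ℂ] H) [IsStarNormal N] (h : H) :
    IsFiniteMeasure (spectrumMeasure N h) :=
  ⟨isCompact_univ.measure_lt_top⟩

theorem measurableEmbedding_spectrum_val (N : H →L[ℂ] H) :
    MeasurableEmbedding (Subtype.val : spectrum ℂ N → ℂ) :=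
  .subtype_coe (spectrum.isClosed N).measurableSet

instance isFiniteMeasure_spectralMeasure (N : H →L[ℂ] H) [IsStarNormal N] (h : H) :
    IsFiniteMeasure (spectralMeasure N h) :=
  inferInstanceAs (IsFiniteMeasure ((spectrumMeasure N h).map Subtype.val))

theorem integral_spectrumMeasure (N : H →L[ℂ] H) [hN : IsStarNormal N] (h : H)
    (f : C(spectrum ℂ N, ℝ)) :
    ∫ x, f x ∂(spectrumMeasure N h) = (inner ℂ h (cfcHom hN (ofRealCont f) h)).re :=
  RealRMK.integral_rieszMeasure (spectralFunctional N h)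
    (CompactlySupportedContinuousMap.continuousMapEquiv f)

theorem integral_norm_sq_spectrumMeasure (N : H →L[ℂ] H) [hN : IsStarNormal N] (h : H)
    (f : C(spectrum ℂ N, ℂ)) :
    ∫ x, ‖f x‖ ^ 2 ∂(spectrumMeasure N h) = ‖cfcHom hN f h‖ ^ 2 := by
  have h1 := integral_spectrumMeasure N h ⟨fun x => ‖f x‖ ^ 2, by fun_prop⟩
  have h2 : ofRealCont (⟨fun x => ‖f x‖ ^ 2, by fun_prop⟩ : C(spectrum ℂ N, ℝ)) = star f * f := by
    ext x
    simp [ofRealCont, Complex.conj_mul']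
  rw [h2, map_mul, map_star, mul_apply_eq_comp, ContinuousLinearMap.star_eq_adjoint,
    ContinuousLinearMap.adjoint_inner_right, inner_self_eq_norm_sq_to_K] at h1
  simpa [← Complex.ofReal_pow] using h1

theorem integral_mul_spectrumMeasure (N : H →L[ℂ] H) [hN : IsStarNormal N] (h : H)
    (f g : C(spectrum ℂ N, ℝ)) :
    ∫ x, f x * g x ∂(spectrumMeasure N h) =
      (inner ℂ (cfcHom hN (ofRealCont f) h) (cfcHom hN (ofRealCont g) h)).re := by
  have h1 := integral_spectrumMeasure N h (f * g)
  rw [ofRealCont_mul, ← star_ofRealCont f, map_mul, map_star, mul_apply_eq_comp,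
    ContinuousLinearMap.star_eq_adjoint, ContinuousLinearMap.adjoint_inner_right] at h1
  exact h1

theorem spectralMeasure_real_univ (N : H →L[ℂ] H) [hN : IsStarNormal N] (h : H) :
    (spectralMeasure N h).real Set.univ = ‖h‖ ^ 2 := by
  have h1 := integral_norm_sq_spectrumMeasure N h 1
  rw [map_one] at h1
  rw [measureReal_def, spectralMeasure, Measure.map_apply measurable_subtype_coe .univ]
  simpa [measureReal_def, spectrumMeasure] using h1

/-- `f ↦ f(N) h` is isometric for the `L²` norm of the spectral measure at `h`; this lets the
functional calculus at `h` extend from continuous to square-integrable functions. -/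
theorem norm_sub_sq_eq_integral (N : H →L[ℂ] H) [hN : IsStarNormal N] (h : H)
    (f g : C(spectrum ℂ N, ℝ)) :
    ‖cfcHom hN (ofRealCont f) h - cfcHom hN (ofRealCont g) h‖ =
      ‖ContinuousMap.toLp 2 (spectrumMeasure N h) ℝ f -
        ContinuousMap.toLp 2 (spectrumMeasure N h) ℝ g‖ := by
  rw [← sq_eq_sq₀ (norm_nonneg _) (norm_nonneg _), ← sub_apply, ← map_sub, ← ofRealCont_sub,
    ← integral_norm_sq_spectrumMeasure, ← map_sub, ← real_inner_self_eq_norm_sq, L2.inner_def]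
  refine integral_congr_ae ?_
  filter_upwards [ContinuousMap.coeFn_toLp (p := 2) (𝕜 := ℝ) (spectrumMeasure N h) (f - g)] with x hx
  rw [hx]
  simp only [ofRealCont, ContinuousMap.coe_mk, ContinuousMap.sub_apply, Complex.norm_real, sq,
    Real.norm_eq_abs, abs_mul_abs_self]
  simp [sq]

/-- Every square-integrable function `g` on the spectrum gives a vector whose scalar spectral
measure has density `|g| ^ 2` with respect to that of the given vector. -/
theorem exists_integral_spectrumMeasure_eq (N : H →L[ℂ] H) [hN : IsStarNormal N] (h : H)
    {g : spectrum ℂ N → ℝ} (hg : MemLp g 2 (spectrumMeasure N h)) :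
    ∃ ξ : H, ∀ φ : C(spectrum ℂ N, ℝ),
      ∫ x, φ x ∂(spectrumMeasure N ξ) = ∫ x, φ x * g x ^ 2 ∂(spectrumMeasure N h) := by
  set ν := spectrumMeasure N h with hν
  -- Approximate `g` in `L²` by continuous `f n`; the vectors `f n (N) h` are then Cauchy, and `ξ`
  -- is their limit, morally `g(N) h`.
  have hmem := ContinuousMap.toLp_denseRange ℝ ν ℝ (p := 2) (by simp) (hg.toLp g)
  obtain ⟨G, hGr, hG⟩ := mem_closure_iff_seq_limit.mp hmem
  choose f hf using hGr
  obtain rfl : (fun n => ContinuousMap.toLp 2 ν ℝ (f n)) = G := funext hf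
  have hcau : CauchySeq fun n => cfcHom hN (ofRealCont (f n)) h := by
    have := hG.cauchySeq
    rw [Metric.cauchySeq_iff] at this ⊢
    simpa only [dist_eq_norm, norm_sub_sq_eq_integral] using this
  obtain ⟨ξ, hξ⟩ := cauchySeq_tendsto_of_complete hcau
  refine ⟨ξ, fun φ => ?_⟩
  -- Multiplication by `φ` is bounded on `L²`, so both `⟨φ(N) f n (N) h, f n (N) h⟩` and `∫ φ (f
  -- n)²` pass to the limit.
  let M : Lp ℝ 2 ν →L[ℝ] Lp ℝ 2 ν :=
    ContinuousLinearMap.holderL ν ⊤ 2 2 (ContinuousLinearMap.mul ℝ ℝ) (ContinuousMap.toLp ⊤ ν ℝ φ)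
  have hM : ∀ F : Lp ℝ 2 ν, M F =ᵐ[ν] fun x => φ x * F x := by
    intro F
    filter_upwards [ContinuousLinearMap.coeFn_holder (r := 2) (ContinuousLinearMap.mul ℝ ℝ)
      (ContinuousMap.toLp ⊤ ν ℝ φ) F, ContinuousMap.coeFn_toLp (p := ⊤) (𝕜 := ℝ) ν φ] with x h1 h2
    rw [← h2]
    exact h1
  have t1 : Filter.Tendsto (fun n => (inner ℂ (cfcHom hN (ofRealCont (f n)) h)
      (cfcHom hN (ofRealCont φ) (cfcHom hN (ofRealCont (f n)) h))).re) Filter.atTop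
      (nhds (inner ℂ ξ (cfcHom hN (ofRealCont φ) ξ)).re) :=
    (Complex.continuous_re.tendsto _).comp
      (hξ.inner (((cfcHom hN (ofRealCont φ)).continuous.tendsto ξ).comp hξ))
  have t2 := hG.inner ((M.continuous.tendsto _).comp hG) (𝕜 := ℝ)
  rw [integral_spectrumMeasure]
  have e1 : ∀ n, (inner ℂ (cfcHom hN (ofRealCont (f n)) h)
      (cfcHom hN (ofRealCont φ) (cfcHom hN (ofRealCont (f n)) h))).re =
      inner ℝ (ContinuousMap.toLp 2 ν ℝ (f n)) (M (ContinuousMap.toLp 2 ν ℝ (f n))) := by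
    intro n
    rw [← mul_apply_eq_comp, ← map_mul, ← ofRealCont_mul, ← integral_mul_spectrumMeasure,
      L2.inner_def]
    refine integral_congr_ae ?_
    filter_upwards [hM (ContinuousMap.toLp 2 ν ℝ (f n)),
      ContinuousMap.coeFn_toLp (p := 2) (𝕜 := ℝ) ν (f n)] with x h1 h2
    rw [h1, h2]
    simp; ring
  simp_rw [e1] at t1
  rw [tendsto_nhds_unique t1 t2, L2.inner_def]
  refine integral_congr_ae ?_
  filter_upwards [hM (hg.toLp g), hg.coeFn_toLp] with x h1 h2
  rw [h1, h2]
  simp; ring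

/-- Use the vector attached to the square root of `G`; on the spectrum, finite regular measures are
determined by their integrals of continuous functions. -/
theorem exists_spectrumMeasure_eq_withDensity (N : H →L[ℂ] H) [IsStarNormal N] (h : H)
    {G : spectrum ℂ N → ENNReal} (hG : Measurable G) (hGt : ∀ x, G x ≠ ⊤)
    (hGi : ∫⁻ x, G x ∂(spectrumMeasure N h) ≠ ⊤) :
    ∃ ξ : H, spectrumMeasure N ξ = (spectrumMeasure N h).withDensity G := by
  have hsq : ∀ x, Real.sqrt (G x).toReal ^ 2 = (G x).toReal := fun x =>
    Real.sq_sqrt ENNReal.toReal_nonneg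
  have hmeas : Measurable fun x => Real.sqrt (G x).toReal := by fun_prop
  have hg : MemLp (fun x => Real.sqrt (G x).toReal) 2 (spectrumMeasure N h) := by
    rw [memLp_two_iff_integrable_sq hmeas.aestronglyMeasurable]
    simp_rw [hsq]
    exact integrable_toReal_of_lintegral_ne_top hG.aemeasurable hGi
  obtain ⟨ξ, hξ⟩ := exists_integral_spectrumMeasure_eq N h hg
  refine ⟨ξ, ?_⟩
  have : IsFiniteMeasure ((spectrumMeasure N h).withDensity G) := isFiniteMeasure_withDensity hGi
  refine Measure.ext_of_integral_eq_on_compactlySupported fun φ => ?_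
  rw [integral_withDensity_eq_integral_toReal_smul hG (.of_forall fun x => (hGt x).lt_top)]
  refine (hξ φ.toContinuousMap).trans (integral_congr_ae (.of_forall fun x => ?_))
  simp only [hsq, smul_eq_mul]
  exact mul_comm _ _

theorem exists_spectralMeasure_eq_withDensity (N : H →L[ℂ] H) [IsStarNormal N] (h : H)
    {G : ℂ → ENNReal} (hG : Measurable G) (hGt : ∀ x, G x ≠ ⊤)
    (hGi : ∫⁻ x, G x ∂(spectralMeasure N h) ≠ ⊤) :
    ∃ ξ : H, spectralMeasure N ξ = (spectralMeasure N h).withDensity G := by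
  have hm : ∀ k, spectralMeasure N k = (spectrumMeasure N k).map Subtype.val := fun _ => rfl
  rw [hm, lintegral_map hG measurable_subtype_coe] at hGi
  obtain ⟨ξ, hξ⟩ := exists_spectrumMeasure_eq_withDensity N h
    (hG.comp measurable_subtype_coe) (fun x => hGt x) hGi
  refine ⟨ξ, ?_⟩
  ext s hs
  rw [hm, hm, hξ, Measure.map_apply measurable_subtype_coe hs, withDensity_apply _ hs,
    withDensity_apply _ (measurable_subtype_coe hs), setLIntegral_map hs hG measurable_subtype_coe]
  rfl

/-! ### Normalized Lebesgue measure and the Poisson kernel -/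

theorem circleMeasure_compl_sphere : circleMeasure (Metric.sphere 0 1)ᶜ = 0 := by
  have hm : Measurable fun t : ℝ => Complex.exp ((t : ℂ) * Complex.I) := by fun_prop
  rw [circleMeasure, Measure.smul_apply,
    Measure.map_apply hm Metric.isClosed_sphere.measurableSet.compl]
  have : (fun t : ℝ => Complex.exp ((t : ℂ) * Complex.I)) ⁻¹' (Metric.sphere 0 1)ᶜ = ∅ := by
    ext t
    simp [Complex.norm_exp_ofReal_mul_I]
  simp [this]

instance isProbabilityMeasure_circleMeasure : IsProbabilityMeasure circleMeasure := by
  constructor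
  have hm : Measurable fun t : ℝ => Complex.exp ((t : ℂ) * Complex.I) := by fun_prop
  rw [circleMeasure, Measure.smul_apply, Measure.map_apply hm .univ]
  simp only [Set.preimage_univ, Measure.restrict_apply_univ, Real.volume_Ioc, sub_zero, smul_eq_mul]
  exact ENNReal.inv_mul_cancel (by simp [Real.pi_pos]) ENNReal.ofReal_ne_top

theorem integral_circleMeasure {φ : ℂ → ℝ} (hφ : Measurable φ) :
    ∫ x, φ x ∂circleMeasure = Real.circleAverage φ 0 1 := by
  have hm : Measurable fun t : ℝ => Complex.exp ((t : ℂ) * Complex.I) := by fun_prop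
  rw [circleMeasure, integral_smul_measure,
    integral_map hm.aemeasurable hφ.aestronglyMeasurable, Real.circleAverage_def,
    intervalIntegral.integral_of_le (by positivity)]
  simp [circleMap, Real.pi_pos.le]

theorem integral_poisson_circleMeasure {z : ℂ} (hz : ‖z‖ < 1) :
    Integrable (fun x => (‖1 - z * x‖ ^ 2)⁻¹) circleMeasure ∧
      (1 - ‖z‖ ^ 2) * ∫ x, (‖1 - z * x‖ ^ 2)⁻¹ ∂circleMeasure = 1 := by
  have hme : Measurable fun x : ℂ => (‖1 - z * x‖ ^ 2)⁻¹ := by fun_prop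
  constructor
  · refine Integrable.of_bound hme.aestronglyMeasurable (((1 - ‖z‖) ^ 2)⁻¹) ?_
    have : ∀ᵐ x ∂circleMeasure, x ∈ Metric.sphere (0 : ℂ) 1 := circleMeasure_compl_sphere
    filter_upwards [this] with x hx
    have hx1 : ‖x‖ = 1 := by simpa using hx
    have h1 : 1 - ‖z‖ ≤ ‖1 - z * x‖ := by
      simpa [hx1] using norm_sub_norm_le (1 : ℂ) (z * x)
    have h0 : 0 < 1 - ‖z‖ := by linarith
    rw [Real.norm_of_nonneg (by positivity)]
    gcongr
  · have hf : DiffContOnCl ℂ (fun _ : ℂ => (1 : ℂ)) (Metric.ball 0 1) := diffContOnCl_const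
    -- The Poisson formula for the constant function 1 at `conj z`: on the circle `|1 - z x| = |x -
    -- conj z|`.
    have hp := hf.circleAverage_poissonKernel_smul' (w := (starRingEnd ℂ) z) (by simpa using hz)
    rw [integral_circleMeasure hme, ← smul_eq_mul, ← Real.circleAverage_fun_smul]
    have h2 : Real.circleAverage (fun x : ℂ => (1 - ‖z‖ ^ 2) • (‖1 - z * x‖ ^ 2)⁻¹) 0 1 =
        Real.circleAverage (fun x => ((‖x - 0‖ ^ 2 - ‖(starRingEnd ℂ) z - 0‖ ^ 2) /
          ‖(x - 0) - ((starRingEnd ℂ) z - 0)‖ ^ 2)) 0 1 := by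
      refine Real.circleAverage_congr_sphere fun x hx => ?_
      have hx1 : ‖x‖ = 1 := by simpa using hx
      have h3 : ‖1 - z * x‖ = ‖x - (starRingEnd ℂ) z‖ := by
        have : (starRingEnd ℂ) x * (x - (starRingEnd ℂ) z) = (starRingEnd ℂ) (1 - z * x) := by
          rw [mul_sub, Complex.conj_mul', hx1]
          simp [mul_comm]
        rw [← Complex.norm_conj (1 - z * x), ← this, norm_mul, Complex.norm_conj, hx1, one_mul]
      simp [hx1, h3, div_eq_mul_inv]
    rw [h2]
    simp only [Real.circleAverage_def, Complex.real_smul, mul_one,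
      intervalIntegral.integral_ofReal] at hp ⊢
    rw [smul_eq_mul]
    exact_mod_cast hp

/-! ### Absolutely continuous unitary operators -/

theorem norm_unitary_apply (U : unitary (H →L[ℂ] H)) (x : H) : ‖(U : H →L[ℂ] H) x‖ = ‖x‖ := by
  have h1 : star (U : H →L[ℂ] H) * U = 1 := Unitary.star_mul_self_of_mem U.2
  have h2 : inner ℂ ((U : H →L[ℂ] H) x) ((U : H →L[ℂ] H) x) = inner ℂ x x := by
    rw [← ContinuousLinearMap.adjoint_inner_right, ← ContinuousLinearMap.star_eq_adjoint,
      ← mul_apply_eq_comp, h1, one_apply_eq_self]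
  rw [@norm_eq_sqrt_re_inner ℂ, h2, ← @norm_eq_sqrt_re_inner ℂ]

/-- The spectrum lies on the circle, so `x ↦ (1 - z x)⁻¹` is continuous on it, and the functional
calculus sends it to the resolvent. -/
theorem norm_resolventSeries_unitary_sq (U : unitary (H →L[ℂ] H)) {z : ℂ} (hz : ‖z‖ < 1) (h : H) :
    ‖resolventSeries (U : H →L[ℂ] H) z h‖ ^ 2 =
      ∫ x, (‖1 - z * x‖ ^ 2)⁻¹ ∂(spectralMeasure (U : H →L[ℂ] H) h) := by
  set N := (U : H →L[ℂ] H) with hNU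
  have hN : IsStarNormal N := inferInstance
  have hN1 : ‖N‖ ≤ 1 := ContinuousLinearMap.opNorm_le_bound _ zero_le_one fun x => by
    simp [hNU, norm_unitary_apply]
  have hne : ∀ x : spectrum ℂ N, 1 - z * x ≠ 0 := by
    intro x h0
    have hx : ‖(x : ℂ)‖ = 1 := by simpa using spectrum.subset_circle_of_unitary U.2 x.2
    have : z * x = 1 := (sub_eq_zero.mp h0).symm
    have := congrArg norm this
    simp [hx] at this
    linarith
  let f : C(spectrum ℂ N, ℂ) := ⟨fun x => (1 - z * x)⁻¹, by fun_prop (disch := exact hne)⟩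
  let e : C(spectrum ℂ N, ℂ) := (ContinuousMap.id ℂ).restrict (spectrum ℂ N)
  have hfe : f * (1 - z • e) = 1 := by
    ext x
    simpa [f, e] using inv_mul_cancel₀ (hne x)
  have hf : cfcHom hN f = resolventSeries N z := by
    have h1 : cfcHom hN f * (1 - z • N) = 1 := by
      have := congrArg (cfcHom hN) hfe
      rwa [map_mul, map_sub, map_smul, map_one, cfcHom_id] at this
    calc cfcHom hN f = cfcHom hN f * ((1 - z • N) * resolventSeries N z) := by
          rw [one_sub_mul_resolventSeries hN1 hz, mul_one]
      _ = resolventSeries N z := by rw [← mul_assoc, h1, one_mul]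
  rw [← hf, ← integral_norm_sq_spectrumMeasure]
  change _ = ∫ x, _ ∂((spectrumMeasure N h).map Subtype.val)
  rw [(measurableEmbedding_spectrum_val N).integral_map]
  simp [f]

/-- The spectral measure at `ξ` has density at most `1 / m(ω)`, and the Poisson kernel has
`m`-integral 1; so the kernel of `U` at `ξ` is at most `1 / m(ω)`. -/
theorem harnackDominated_unitary (U : unitary (H →L[ℂ] H)) {ω : Set ℂ} {ξ : H}
    (hξ : ‖ξ‖ = 1)
    (hU : spectralMeasure (U : H →L[ℂ] H) ξ = (circleMeasure ω)⁻¹ • circleMeasure.restrict ω) :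
    HarnackDominated (U : H →L[ℂ] H) (rankOnePerturbation (U : H →L[ℂ] H) ξ) := by
  refine harnackDominated_rankOnePerturbation (norm_unitary_apply U) hξ
    (C := ((circleMeasure ω)⁻¹).toReal) fun z hz => ?_
  obtain ⟨hi, h1⟩ := integral_poisson_circleMeasure hz
  rw [norm_resolventSeries_unitary_sq U hz, hU, integral_smul_measure, smul_eq_mul]
  have h2 : ∫ x in ω, (‖1 - z * x‖ ^ 2)⁻¹ ∂circleMeasure ≤
      ∫ x, (‖1 - z * x‖ ^ 2)⁻¹ ∂circleMeasure :=
    setIntegral_le_integral hi (.of_forall fun x => by positivity)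
  have hz2 : 0 ≤ 1 - ‖z‖ ^ 2 := by nlinarith [norm_nonneg z]
  calc (1 - ‖z‖ ^ 2) * (((circleMeasure ω)⁻¹).toReal *
        ∫ x in ω, (‖1 - z * x‖ ^ 2)⁻¹ ∂circleMeasure)
      ≤ (1 - ‖z‖ ^ 2) * (((circleMeasure ω)⁻¹).toReal *
        ∫ x, (‖1 - z * x‖ ^ 2)⁻¹ ∂circleMeasure) := by gcongr
    _ = ((circleMeasure ω)⁻¹).toReal * ((1 - ‖z‖ ^ 2) *
        ∫ x, (‖1 - z * x‖ ^ 2)⁻¹ ∂circleMeasure) := by ring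
    _ = ((circleMeasure ω)⁻¹).toReal := by rw [h1, mul_one]

theorem exists_spectralMeasure_eq_restrict [Nontrivial H] {U : unitary (H →L[ℂ] H)}
    (hU : IsAbsContUnitary U) :
    ∃ (ω : Set ℂ) (ξ : H), ω ⊆ Metric.sphere 0 1 ∧ MeasurableSet ω ∧
      circleMeasure ω ≠ 0 ∧ ‖ξ‖ = 1 ∧
      spectralMeasure (U : H →L[ℂ] H) ξ = (circleMeasure ω)⁻¹ • circleMeasure.restrict ω := by
  obtain ⟨h, hh⟩ := exists_ne (0 : H)
  set N := (U : H →L[ℂ] H) with hNU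
  set μ := spectralMeasure N h with hμ
  set f := μ.rnDeriv circleMeasure with hf
  have hfm : Measurable f := Measure.measurable_rnDeriv _ _
  have hμf : circleMeasure.withDensity f = μ := Measure.withDensity_rnDeriv_eq _ _ (hU h)
  -- Were this set `m`-null, `f` would vanish almost everywhere, giving `μ = 0` against `μ(ℂ) = ‖h‖²
  -- ≠ 0`.
  set ω : Set ℂ := Metric.sphere 0 1 ∩ {x | f x ≠ 0 ∧ f x ≠ ⊤} with hω
  have hωm : MeasurableSet ω := Metric.isClosed_sphere.measurableSet.inter
    ((hfm (measurableSet_singleton 0).compl).inter (hfm (measurableSet_singleton ⊤).compl))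
  have hω0 : circleMeasure ω ≠ 0 := by
    intro h0
    have hsph : ∀ᵐ x ∂circleMeasure, x ∈ Metric.sphere (0 : ℂ) 1 := circleMeasure_compl_sphere
    have hf0 : f =ᵐ[circleMeasure] 0 := by
      filter_upwards [hsph, Measure.rnDeriv_lt_top μ circleMeasure,
        measure_eq_zero_iff_ae_notMem.mp h0] with x h1 h2 h3
      by_contra h4
      exact h3 ⟨h1, h4, h2.ne⟩
    have hμ0 : μ = 0 := by rw [← hμf, withDensity_congr_ae hf0, withDensity_zero]
    have := spectralMeasure_real_univ N h
    rw [← hμ, hμ0] at this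
    simp only [measureReal_zero, Pi.zero_apply] at this
    exact pow_ne_zero 2 (norm_ne_zero_iff.mpr hh) this.symm
  have hωt : circleMeasure ω ≠ ⊤ := measure_ne_top _ _
  -- Chosen so that `f * G` is the constant `1 / m(ω)` on `ω` and 0 elsewhere.
  set G : ℂ → ENNReal := ω.indicator fun x => (f x * circleMeasure ω)⁻¹ with hG
  have hGm : Measurable G := Measurable.indicator (by fun_prop) hωm
  have hGt : ∀ x, G x ≠ ⊤ := by
    intro x
    by_cases hx : x ∈ ω
    · simp [hG, hx, hω0, hx.2.1]
    · simp [hG, hx]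
  have hdens : μ.withDensity G = (circleMeasure ω)⁻¹ • circleMeasure.restrict ω := by
    have h1 : f * G = ω.indicator fun _ => (circleMeasure ω)⁻¹ := by
      ext x
      by_cases hx : x ∈ ω
      · simp only [hG, Pi.mul_apply, Set.indicator_of_mem hx]
        rw [ENNReal.mul_inv (.inl hx.2.1) (.inl hx.2.2), ← mul_assoc,
          ENNReal.mul_inv_cancel hx.2.1 hx.2.2, one_mul]
      · simp [hG, hx]
    rw [← hμf, ← withDensity_mul _ hfm hGm, h1, withDensity_indicator hωm, withDensity_const]
  have hmass : μ.withDensity G Set.univ = 1 := by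
    rw [hdens]
    simp [ENNReal.inv_mul_cancel hω0 hωt]
  obtain ⟨ξ, hξ⟩ := exists_spectralMeasure_eq_withDensity N h hGm hGt (by
    rw [withDensity_apply _ .univ, Measure.restrict_univ] at hmass
    rw [← hμ, hmass]
    simp)
  refine ⟨ω, ξ, Set.inter_subset_left, hωm, hω0, ?_, hξ.trans hdens⟩
  have h1 := spectralMeasure_real_univ N ξ
  rw [measureReal_def, hξ, ← hμ, hmass] at h1
  rw [← sq_eq_sq₀ (norm_nonneg _) zero_le_one, ← h1]
  simp

end HarnackDom

theorem mainTheorem5 {H : Type*} [NormedAddCommGroup H] [InnerProductSpace ℂ H] [CompleteSpace H]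
    [Nontrivial H] :
    -- absolutely continuous unitary operators
    (∀ U : unitary (H →L[ℂ] H), HarnackDom.IsAbsContUnitary U →
      ¬ HarnackDom.IsHarnackMaximal (U : H →L[ℂ] H) ∧
      (∃ (ω : Set ℂ) (ξ : H), ω ⊆ Metric.sphere 0 1 ∧ MeasurableSet ω ∧
        HarnackDom.circleMeasure ω ≠ 0 ∧ ‖ξ‖ = 1 ∧
        HarnackDom.spectralMeasure (U : H →L[ℂ] H) ξ =
          (HarnackDom.circleMeasure ω)⁻¹ • HarnackDom.circleMeasure.restrict ω) ∧
      (∀ (ω : Set ℂ) (ξ : H), ω ⊆ Metric.sphere 0 1 → MeasurableSet ω →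
        HarnackDom.circleMeasure ω ≠ 0 → ‖ξ‖ = 1 →
        HarnackDom.spectralMeasure (U : H →L[ℂ] H) ξ =
          (HarnackDom.circleMeasure ω)⁻¹ • HarnackDom.circleMeasure.restrict ω →
        ‖HarnackDom.rankOnePerturbation (U : H →L[ℂ] H) ξ‖ ≤ 1 ∧
        HarnackDom.rankOnePerturbation (U : H →L[ℂ] H) ξ ≠ U ∧
        HarnackDom.HarnackDominated (U : H →L[ℂ] H)
          (HarnackDom.rankOnePerturbation (U : H →L[ℂ] H) ξ))) ∧
    -- unilateral shifts of arbitrary multiplicity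
    (∀ (S : H →L[ℂ] H) (L : Submodule ℂ H), HarnackDom.IsUnilateralShift S L →
      ¬ HarnackDom.IsHarnackMaximal S ∧
      (∃ ξ ∈ L, ‖ξ‖ = 1) ∧
      (∀ ξ ∈ L, ‖ξ‖ = 1 →
        ‖HarnackDom.rankOnePerturbation S ξ‖ ≤ 1 ∧
        HarnackDom.rankOnePerturbation S ξ ≠ S ∧
        HarnackDom.HarnackDominated S (HarnackDom.rankOnePerturbation S ξ))) := by
  refine ⟨fun U hU => ?_, fun S L hS => ?_⟩
  · have hUi := HarnackDom.norm_unitary_apply U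
    obtain ⟨ω, ξ, hω, hωm, hω0, hξ, hμ⟩ :=
      HarnackDom.exists_spectralMeasure_eq_restrict hU
    refine ⟨fun hmax => ?_, ⟨ω, ξ, hω, hωm, hω0, hξ, hμ⟩,
      fun ω ξ _ _ _ hξ hμ =>
      ⟨HarnackDom.norm_rankOnePerturbation_le hUi hξ, HarnackDom.rankOnePerturbation_ne hUi hξ,
        HarnackDom.harnackDominated_unitary U hξ hμ⟩⟩
    exact HarnackDom.rankOnePerturbation_ne hUi hξ (hmax _
      (HarnackDom.norm_rankOnePerturbation_le hUi hξ)
      (HarnackDom.harnackDominated_unitary U hξ hμ))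
  · obtain ⟨ξ, hξL, hξ⟩ := hS.exists_norm_eq_one
    refine ⟨fun hmax => ?_, ⟨ξ, hξL, hξ⟩, fun ξ hξL hξ =>
      ⟨HarnackDom.norm_rankOnePerturbation_le hS.isometry hξ,
        HarnackDom.rankOnePerturbation_ne hS.isometry hξ, hS.harnackDominated hξL hξ⟩⟩
    exact HarnackDom.rankOnePerturbation_ne hS.isometry hξ (hmax _
      (HarnackDom.norm_rankOnePerturbation_le hS.isometry hξ) (hS.harnackDominated hξL hξ))
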